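/- Let $k$ be a field and let $R_1, R_2$ be local $k$-algebras, i.e. commutative noetherian local rings equipped with a $k$-algebra structure. For a commutative ring $R$, an $R$-module $C$ is called \emph{semidualizing} if it is finitely generated, the homothety map $R\to \operatorname{Hom}_R(C,C)$, $r\mapsto (c\mapsto rc)$, is an isomorphism, and $\operatorname{Ext}^i_R(C,C)=0$ for all $i>0$; let $\mathfrak{S}_0(R)$ denote the set of isomorphism classes of semidualizing $R$-modules. Tensor products $X_1\otimes_k X_2$ of an $R_1$-module and an $R_2$-module are regarded as $R_1\otimes_k R_2$-modules via $(r_1\otimes r_2)(x_1\otimes x_2)=(r_1x_1)\otimes(r_2x_2)$. (1) Let $X_i$ be a finitely generated $R_i$-module for $i=1,2$. Then $X_1\otimes_k X_2$ is a semidualizing $R_1\otimes_k R_2$-module if and only if $X_1$ is a semidualizing $R_1$-module and $X_2$ is a semidualizing $R_2$-module. (2) The map $\psi:\mathfrak{S}_0(R_1)\times\mathfrak{S}_0(R_2)\to\mathfrak{S}_0(R_1\otimes_k R_2)$ given by $\psi([C_1],[C_2])=[C_1\otimes_k C_2]$ is well defined and injective. -/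

import Mathlib

open scoped TensorProduct

universe u v w

/-- A module `C` over a commutative ring `R` is semidualizing if it is finitely generated, the
homothety map `R → Hom_R(C, C)`, `r ↦ (c ↦ r • c)`, is an isomorphism, and `Ext_R^i(C, C) = 0` for
all `i > 0`. -/
structure IsSemidualizing (R : Type u) [CommRing R] (C : Type u) [AddCommGroup C] [Module R C] :
    Prop where
  finite : Module.Finite R C
  homothety_bijective : Function.Bijective (LinearMap.lsmul R C : R →ₗ[R] (C →ₗ[R] C))
  ext_eq_zero : ∀ i : ℕ, 0 < i →
    Subsingleton (CategoryTheory.Abelian.Ext.{u} (ModuleCat.of R C) (ModuleCat.of R C) i)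

/-- The isomorphism relation on semidualizing `R`-modules. -/
def semidualizingSetoid (R : Type u) [CommRing R] :
    Setoid {M : ModuleCat.{u} R // IsSemidualizing R M} where
  r M N := Nonempty (M.1 ≃ₗ[R] N.1)
  iseqv :=
    { refl := fun M => ⟨LinearEquiv.refl R M.1⟩
      symm := fun ⟨e⟩ => ⟨e.symm⟩
      trans := fun ⟨e⟩ ⟨f⟩ => ⟨e.trans f⟩ }

/-- `𝔖₀(R)`: the set of isomorphism classes of semidualizing `R`-modules. -/
def SemidualizingClasses (R : Type u) [CommRing R] : Type (u + 1) :=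
  Quotient (semidualizingSetoid R)

/-- The isomorphism class of a semidualizing `R`-module `C`. -/
def SemidualizingClasses.mk (R : Type u) [CommRing R] (C : Type u) [AddCommGroup C] [Module R C]
    (h : IsSemidualizing R C) : SemidualizingClasses R :=
  Quotient.mk (semidualizingSetoid R) ⟨ModuleCat.of R C, h⟩

section TensorAction

variable (k : Type w) [Field k] (R₁ : Type u) (R₂ : Type v) [CommRing R₁] [CommRing R₂]
  [Algebra k R₁] [Algebra k R₂] (X₁ : Type u) (X₂ : Type v) [AddCommGroup X₁] [AddCommGroup X₂]
  [Module k X₁] [Module k X₂] [Module R₁ X₁] [Module R₂ X₂] [IsScalarTower k R₁ X₁]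
  [IsScalarTower k R₂ X₂]

/-- The `k`-algebra homomorphism `R₁ ⊗ R₂ → End_k(X₁ ⊗ X₂)` sending `r ⊗ s` to
`x ⊗ y ↦ (r • x) ⊗ (s • y)`. -/
noncomputable def tensorAction : R₁ ⊗[k] R₂ →ₐ[k] Module.End k (X₁ ⊗[k] X₂) :=
  (Module.endTensorEndAlgHom (R := k) (S := k) (A := k) (M := X₁) (N := X₂)).comp
    (Algebra.TensorProduct.map (Algebra.lsmul k k X₁) (Algebra.lsmul k k X₂))

/-- The `R₁ ⊗ R₂`-module structure on `X₁ ⊗ X₂`. It is not registered as an instance, since for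
`X₁ = R₁` and `X₂ = R₂` it would compete with the action of the ring `R₁ ⊗ R₂` on itself. -/
@[reducible] noncomputable def tensorModule : Module (R₁ ⊗[k] R₂) (X₁ ⊗[k] X₂) :=
  Module.compHom (X₁ ⊗[k] X₂) (tensorAction k R₁ R₂ X₁ X₂).toRingHom

theorem tensorModule_tmul_smul_tmul (r : R₁) (s : R₂) (x : X₁) (y : X₂) :
    letI := tensorModule k R₁ R₂ X₁ X₂
    (r ⊗ₜ[k] s) • (x ⊗ₜ[k] y) = (r • x) ⊗ₜ[k] (s • y) :=
  rfl

end TensorAction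

/-!
Put `S = R₁ ⊗ R₂`. Over a field, `Hom_S(A₁ ⊗ A₂, B₁ ⊗ B₂) = Hom_{R₁}(A₁, B₁) ⊗ Hom_{R₂}(A₂, B₂)` for
finitely generated `A₁` and `A₂` (`homTensorHom_bijective`). Under this identification the homothety
of `X₁ ⊗ X₂` is the tensor product of the homotheties of the factors, and a tensor product of
nonzero linear maps over a field is bijective if and only if both maps are
(`lsmul_tensor_bijective_iff`). The Künneth formula for `Ext` is replaced by two weaker facts.

If `Ext_S^i(X₁ ⊗ X₂, X₁ ⊗ X₂)` vanishes, then so does `Ext^i(X₁, X₁)`. The exact functor `- ⊗ X₂`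
sends a class over `R₁` to a class over `S`, and restricting scalars back to `R₁` one finds the
original class as a direct summand, because `k` is a direct summand of the vector space `X₂`
(`ModuleCat.ext_subsingleton_of_retract`).

Conversely, vanishing of `Ext` over both factors gives vanishing over `S` by dimension shifting:
given a finite free cover of `N` with kernel `K`, every `S`-linear map from `X₁ ⊗ K` to `X₁ ⊗ X₂` is
a sum of tensors of maps, so it extends as soon as maps `K → X₂` do
(`ModuleCat.ext_subsingleton_of_shift`). No noetherian hypothesis on `S` is needed, which matters
because `S` may fail to be noetherian.

For injectivity, an isomorphism `C₁ ⊗ C₂ ≅ D₁ ⊗ D₂` and its inverse are sums of tensors of maps.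
Their composition is `1`, so one of the composed pairs of maps consists of multiplications by units
on `C₁` and on `C₂`, and this forces the maps themselves to be isomorphisms
(`IsSemidualizing.nonempty_equiv_of_tensor_equiv`).
-/

open CategoryTheory CategoryTheory.Abelian CategoryTheory.Limits

/-! ### Maps induced by exact functors on `Ext` -/

section Naturality

universe w₁ w₂ w₃ v₁ v₂ u₁ u₂

variable {C : Type u₁} [Category.{v₁} C] [Abelian C] [EnoughProjectives C] [HasExt.{w₁} C]
  {D : Type u₂} [Category.{v₂} D] [Abelian D] [HasExt.{w₂} D]

/-- A natural transformation between exact functors is compatible with the maps they induce on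
`Ext`. Over enough projectives, a class of positive degree is the Yoneda product of the class of a
short exact sequence with a class of smaller degree, which gives an induction on the degree. -/
theorem CategoryTheory.Abelian.Ext.mapExactFunctor_naturality (F G : C ⥤ D)
    [F.Additive] [PreservesFiniteLimits F] [PreservesFiniteColimits F]
    [G.Additive] [PreservesFiniteLimits G] [PreservesFiniteColimits G] (τ : F ⟶ G)
    {X Y : C} {n : ℕ} (x : Ext X Y n) :
    (x.mapExactFunctor F).comp (Ext.mk₀ (τ.app Y)) (add_zero n) =
      (Ext.mk₀ (τ.app X)).comp (x.mapExactFunctor G) (zero_add n) := by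
  induction n generalizing X with
  | zero =>
    obtain ⟨f, rfl⟩ := (Ext.mk₀_bijective X Y).2 x
    simp [Ext.mapExactFunctor_mk₀]
  | succ n ih =>
    let P : ProjectivePresentation X := Classical.arbitrary _
    let S := ShortComplex.mk _ _ (kernel.condition P.f)
    have hS : S.ShortExact := { exact := ShortComplex.exact_kernel P.f }
    have : Projective S.X₂ := P.projective
    obtain ⟨y, rfl⟩ := Ext.contravariant_sequence_exact₃ hS Y x (Ext.eq_zero_of_projective _)
      (add_comm 1 n)
    have nat : (hS.extClass.mapExactFunctor F).comp (Ext.mk₀ (τ.app S.X₁)) (add_zero 1) =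
        (Ext.mk₀ (τ.app S.X₃)).comp (hS.extClass.mapExactFunctor G) (zero_add 1) := by
      rw [Ext.mapExactFunctor_extClass, Ext.mapExactFunctor_extClass]
      exact ShortComplex.ShortExact.extClass_naturality (hS.map_of_exact F)
        (hS.map_of_exact G) (S.mapNatTrans τ)
    rw [Ext.mapExactFunctor_comp, Ext.mapExactFunctor_comp, Ext.comp_assoc_of_third_deg_zero,
      ih y, ← Ext.comp_assoc_of_second_deg_zero, nat]
    exact Ext.comp_assoc _ _ _ _ _ (by lia)

theorem CategoryTheory.Abelian.Ext.mapExactFunctor_comp_functor {E : Type*}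
    [Category* E] [Abelian E] [HasExt.{w₃} E]
    (F : C ⥤ D) [F.Additive] [PreservesFiniteLimits F] [PreservesFiniteColimits F]
    (G : D ⥤ E) [G.Additive] [PreservesFiniteLimits G] [PreservesFiniteColimits G]
    [PreservesFiniteLimits (F ⋙ G)] [PreservesFiniteColimits (F ⋙ G)]
    {X Y : C} {n : ℕ} (x : Ext X Y n) :
    x.mapExactFunctor (F ⋙ G) = (x.mapExactFunctor F).mapExactFunctor G := by
  induction n generalizing X with
  | zero =>
    obtain ⟨f, rfl⟩ := (Ext.mk₀_bijective X Y).2 x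
    simp [Ext.mapExactFunctor_mk₀]
  | succ n ih =>
    let P : ProjectivePresentation X := Classical.arbitrary _
    let S := ShortComplex.mk _ _ (kernel.condition P.f)
    have hS : S.ShortExact := { exact := ShortComplex.exact_kernel P.f }
    have : Projective S.X₂ := P.projective
    obtain ⟨y, rfl⟩ := Ext.contravariant_sequence_exact₃ hS Y x (Ext.eq_zero_of_projective _)
      (add_comm 1 n)
    have nat : hS.extClass.mapExactFunctor (F ⋙ G) =
        (hS.extClass.mapExactFunctor F).mapExactFunctor G := by
      rw [Ext.mapExactFunctor_extClass, Ext.mapExactFunctor_extClass]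
      exact (Ext.mapExactFunctor_extClass G (hS.map_of_exact F)).symm
    rw [Ext.mapExactFunctor_comp, Ext.mapExactFunctor_comp, Ext.mapExactFunctor_comp, ih y, nat]

end Naturality

/-! ### Detecting the vanishing of `Ext` along a retract -/

section Retract

variable {R : Type u} [CommRing R] {S : Type (max u v)} [CommRing S]

/-- If the identity functor is a retract of `F` followed by restriction of scalars, then vanishing
of `Ext` over `S` between the images under `F` implies vanishing of `Ext` over `R`. As `F` enlarges
the universe, the identity functor is replaced by `ModuleCat.uliftFunctor`, which induces bijections
on `Ext`. -/
theorem ModuleCat.ext_subsingleton_of_retract (φ : R →+* S)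
    (F : ModuleCat.{u} R ⥤ ModuleCat.{max u v} S) [F.Additive] [PreservesFiniteLimits F]
    [PreservesFiniteColimits F]
    (ι : ModuleCat.uliftFunctor.{v, u} R ⟶ F ⋙ ModuleCat.restrictScalars φ)
    (ρ : F ⋙ ModuleCat.restrictScalars φ ⟶ ModuleCat.uliftFunctor.{v, u} R)
    (h : ∀ X, ι.app X ≫ ρ.app X = 𝟙 _) (X Y : ModuleCat.{u} R) (n : ℕ)
    [Subsingleton (Ext.{max u v} (F.obj X) (F.obj Y) n)] : Subsingleton (Ext.{u} X Y n) := by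
  have : Small.{max u v} R := small_max.{v, u} R
  have inj := ((ModuleCat.uliftFunctor.{v, u} R).mapExt_bijective_of_preservesProjectiveObjects
    X Y n).injective
  refine subsingleton_of_forall_eq 0 fun x => inj ?_
  have : PreservesFiniteLimits (F ⋙ ModuleCat.restrictScalars φ) := comp_preservesFiniteLimits _ _
  have : PreservesFiniteColimits (F ⋙ ModuleCat.restrictScalars φ) :=
    comp_preservesFiniteColimits _ _
  have hx : x.mapExactFunctor (F ⋙ ModuleCat.restrictScalars φ) = 0 := by
    rw [Ext.mapExactFunctor_comp_functor, Subsingleton.elim (x.mapExactFunctor F) 0,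
      Ext.mapExactFunctor_zero]
  have hι := Ext.mapExactFunctor_naturality _ _ ι x
  rw [hx, Ext.comp_zero] at hι
  rw [map_zero, Functor.mapExtAddHom_apply]
  calc x.mapExactFunctor (ModuleCat.uliftFunctor.{v, u} R)
      = (x.mapExactFunctor (ModuleCat.uliftFunctor.{v, u} R)).comp
          (Ext.mk₀ (ι.app Y ≫ ρ.app Y)) (add_zero n) := by rw [h, Ext.comp_mk₀_id]
    _ = 0 := by
      rw [← Ext.mk₀_comp_mk₀, ← Ext.comp_assoc_of_third_deg_zero, hι, Ext.zero_comp]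

/-- Version of `ModuleCat.ext_subsingleton_of_retract` with the retraction given by additive maps
that are semilinear along `φ`. -/
theorem ModuleCat.ext_subsingleton_of_semilinear_retract (φ : R →+* S)
    (F : ModuleCat.{u} R ⥤ ModuleCat.{max u v} S) [F.Additive] [PreservesFiniteLimits F]
    [PreservesFiniteColimits F]
    (ι : ∀ M : ModuleCat.{u} R, M →+ F.obj M) (ρ : ∀ M : ModuleCat.{u} R, F.obj M →+ M)
    (ι_smul : ∀ (M : ModuleCat.{u} R) (r : R) (m : M), ι M (r • m) = φ r • ι M m)
    (ρ_smul : ∀ (M : ModuleCat.{u} R) (r : R) (z : F.obj M), ρ M (φ r • z) = r • ρ M z)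
    (ι_nat : ∀ {M N : ModuleCat.{u} R} (f : M ⟶ N) (m : M), ι N (f m) = F.map f (ι M m))
    (ρ_nat : ∀ {M N : ModuleCat.{u} R} (f : M ⟶ N) (z : F.obj M), ρ N (F.map f z) = f (ρ M z))
    (ρ_ι : ∀ (M : ModuleCat.{u} R) (m : M), ρ M (ι M m) = m) (X Y : ModuleCat.{u} R) (n : ℕ)
    [Subsingleton (Ext.{max u v} (F.obj X) (F.obj Y) n)] : Subsingleton (Ext.{u} X Y n) := by
  let ι' (M : ModuleCat.{u} R) :
      ULift.{v} M →ₗ[R] ((F ⋙ ModuleCat.restrictScalars φ).obj M) :=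
    { toFun := fun m => ι M m.down
      map_add' := fun a b => map_add (ι M) _ _
      map_smul' := fun r a => ι_smul M r _ }
  let ρ' (M : ModuleCat.{u} R) :
      ((F ⋙ ModuleCat.restrictScalars φ).obj M) →ₗ[R] ULift.{v} M :=
    { toFun := fun z => ULift.up (ρ M z)
      map_add' := fun a b => congrArg ULift.up (map_add (ρ M) _ _)
      map_smul' := fun r a => congrArg ULift.up (ρ_smul M r _) }
  refine ModuleCat.ext_subsingleton_of_retract.{u, v} φ F
    { app := fun M => (ModuleCat.ofHom (ι' M) :), naturality := fun M N f => ?_ }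
    { app := fun M => (ModuleCat.ofHom (ρ' M) :), naturality := fun M N f => ?_ } ?_ X Y n
  · ext m
    exact ι_nat f m.down
  · ext z
    exact congrArg ULift.up (ρ_nat f z)
  · intro M
    ext m
    exact congrArg ULift.up (ρ_ι M m.down)

end Retract

/-! ### Dimension shifting through an exact functor -/

section Shift

universe w'

variable {R : Type u} [CommRing R] {S : Type w'} [CommRing S]

theorem ModuleCat.ext_subsingleton_of_free (F : ModuleCat.{u} R ⥤ ModuleCat.{w'} S) [F.Additive]
    (Y : ModuleCat.{w'} S) (n : ℕ) [Subsingleton (Ext (F.obj (ModuleCat.of R R)) Y n)]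
    (P : ModuleCat.{u} R) [Module.Free R P] [Module.Finite R P] :
    Subsingleton (Ext (F.obj P) Y n) := by
  refine subsingleton_of_forall_eq 0 fun x => ?_
  let b := Module.Free.chooseBasis R P
  let π (i) : P ⟶ ModuleCat.of R R := ModuleCat.ofHom (b.coord i)
  let ι (i) : ModuleCat.of R R ⟶ P := ModuleCat.ofHom (LinearMap.toSpanSingleton R P (b i))
  have hid : 𝟙 P = ∑ i, π i ≫ ι i := by
    ext m
    simp [π, ι, ModuleCat.hom_sum, b.sum_repr]
  have h0 (i) : (Ext.mk₀ (F.map (ι i))).comp x (zero_add n) = 0 := Subsingleton.elim _ _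
  rw [← Ext.mk₀_id_comp x, ← F.map_id, hid, F.map_sum, Ext.mk₀_sum, Ext.sum_comp]
  refine Finset.sum_eq_zero fun i _ => ?_
  rw [F.map_comp, ← Ext.mk₀_comp_mk₀_assoc, h0, Ext.comp_zero]

/-- Let `F` be an exact functor such that `F R` has no higher extensions by `Y`, and such that every
map `F K ⟶ Y` with `K` finitely generated is a sum of maps factoring through `F g` for some
`g : K ⟶ Z`. If a finitely generated module `N` has no higher extensions by `Z`, then `F N` has none
by `Y`. For `0 → K → P → N → 0` with `P` finite free, maps `K ⟶ Z` extend to `P`, hence maps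
`F K ⟶ Y` extend to `F P`; this is degree one, and in higher degrees one passes from `N` to `K`. -/
theorem ModuleCat.ext_subsingleton_of_shift [IsNoetherianRing R]
    (F : ModuleCat.{u} R ⥤ ModuleCat.{w'} S) [F.Additive]
    [PreservesFiniteLimits F] [PreservesFiniteColimits F]
    (Z : ModuleCat.{u} R) (Y : ModuleCat.{w'} S)
    (hF : ∀ n, 0 < n → Subsingleton (Ext (F.obj (ModuleCat.of R R)) Y n))
    (hspan : ∀ (K : ModuleCat.{u} R) [Module.Finite R K] (φ : F.obj K ⟶ Y),
      φ ∈ AddSubgroup.closure {φ | ∃ (g : K ⟶ Z) (h : F.obj Z ⟶ Y), φ = F.map g ≫ h})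
    (N : ModuleCat.{u} R) [Module.Finite R N]
    (hN : ∀ n, 0 < n → Subsingleton (Ext N Z n)) (n : ℕ) (hn : 0 < n) :
    Subsingleton (Ext (F.obj N) Y n) := by
  obtain ⟨n, rfl⟩ : ∃ m, n = m + 1 := ⟨n - 1, by lia⟩
  induction n generalizing N with
  | zero =>
    obtain ⟨P, _, _, _, _, f, hf⟩ := Module.exists_finite_presentation R N
    have hS := LinearMap.shortExact_shortComplexKer hf
    refine subsingleton_of_forall_eq 0 fun x => ?_
    have := hF 1 one_pos
    have := ModuleCat.ext_subsingleton_of_free F Y 1 (ModuleCat.of R P)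
    obtain ⟨y, rfl⟩ := Ext.contravariant_sequence_exact₃ (hS.map_of_exact F) Y x
      (Subsingleton.elim (α := Ext (F.obj (ModuleCat.of R P)) Y 1) _ _) (add_comm 1 0)
    obtain ⟨φ, rfl⟩ := (Ext.mk₀_bijective _ _).2 y
    -- Maps from the syzygy to `Z` extend because `Ext¹(N, Z) = 0`; this suffices by `hspan`.
    have hφ : ∃ φ' : F.obj (ModuleCat.of R P) ⟶ Y, F.map f.shortComplexKer.f ≫ φ' = φ := by
      have hK : Module.Finite R f.shortComplexKer.X₁ :=
        inferInstanceAs (Module.Finite R (LinearMap.ker f))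
      refine AddSubgroup.closure_induction ?_ ?_ ?_ ?_ (hspan f.shortComplexKer.X₁ φ)
      · rintro _ ⟨g, h, rfl⟩
        have := hN 1 one_pos
        obtain ⟨g', hg'⟩ := Ext.contravariant_sequence_exact₁ hS Z (Ext.mk₀ g) (add_zero 1)
          (Subsingleton.elim (α := Ext N Z 1) _ _)
        obtain ⟨g', rfl⟩ := (Ext.mk₀_bijective _ _).2 g'
        rw [Ext.mk₀_comp_mk₀] at hg'
        have hg' := (Ext.mk₀_bijective _ _).1 hg'
        exact ⟨F.map g' ≫ h, by rw [← hg', F.map_comp, Category.assoc]⟩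
      · exact ⟨0, comp_zero⟩
      · rintro _ _ _ _ ⟨a, rfl⟩ ⟨b, rfl⟩
        exact ⟨a + b, by simp⟩
      · rintro _ _ ⟨a, rfl⟩
        exact ⟨-a, by simp⟩
    obtain ⟨φ', rfl⟩ := hφ
    have h0 := (hS.map_of_exact F).extClass_comp_assoc (Ext.mk₀ φ') (n' := 1)
      (h := add_comm 1 0)
    have h1 : (Ext.mk₀ (f.shortComplexKer.map F).f).comp (Ext.mk₀ φ') (zero_add 0) =
        Ext.mk₀ (F.map f.shortComplexKer.f ≫ φ') := Ext.mk₀_comp_mk₀ _ _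
    exact h1 ▸ h0
  | succ n ih =>
    obtain ⟨P, _, _, _, _, f, hf⟩ := Module.exists_finite_presentation R N
    have hS := LinearMap.shortExact_shortComplexKer hf
    have hK : Module.Finite R f.shortComplexKer.X₁ :=
      inferInstanceAs (Module.Finite R (LinearMap.ker f))
    have hproj : Projective (ModuleCat.of R P) := inferInstance
    have := ih f.shortComplexKer.X₁ (fun m hm => by
      refine subsingleton_of_forall_eq 0 fun x => ?_
      have := hN (1 + m) (by lia)
      obtain ⟨y, rfl⟩ := Ext.contravariant_sequence_exact₁ hS Z x rfl
        (Subsingleton.elim (α := Ext N Z (1 + m)) _ _)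
      obtain ⟨m, rfl⟩ : ∃ l, m = l + 1 := ⟨m - 1, by lia⟩
      rw [Ext.eq_zero_of_projective (P := ModuleCat.of R P) y, Ext.comp_zero]) (by lia)
    refine subsingleton_of_forall_eq 0 fun x => ?_
    have := hF (n + 1 + 1) (by lia)
    have := ModuleCat.ext_subsingleton_of_free F Y (n + 1 + 1) (ModuleCat.of R P)
    obtain ⟨y, rfl⟩ := Ext.contravariant_sequence_exact₃ (hS.map_of_exact F) Y x
      (Subsingleton.elim (α := Ext (F.obj (ModuleCat.of R P)) Y _) _ _) (add_comm 1 (n + 1))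
    have hy : y = 0 := Subsingleton.elim (α := Ext (F.obj f.shortComplexKer.X₁) Y _) _ _
    rw [hy, Ext.comp_zero]
    rfl

end Shift

/-! ### Homomorphisms between tensor products over a field -/

section HomTensor

variable {k : Type*} [Field k] {R : Type*} [CommRing R] [Algebra k R]
  {A Y V : Type*} [AddCommGroup A] [Module R A]
  [AddCommGroup Y] [Module k Y] [Module R Y] [IsScalarTower k R Y] [AddCommGroup V] [Module k V]

variable (k R A Y V) in
/-- The canonical map `Hom_R(A, Y) ⊗ V → Hom_R(A, Y ⊗ V)`, sending `f ⊗ v` to `a ↦ f a ⊗ v`. -/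
noncomputable def homTensorRight : (A →ₗ[R] Y) ⊗[k] V →ₗ[k] (A →ₗ[R] Y ⊗[k] V) :=
  TensorProduct.lift
    { toFun := fun f =>
        { toFun := fun v => ((TensorProduct.AlgebraTensorModule.mk k R Y V).flip v).comp f
          map_add' := fun v w => by ext; simp
          map_smul' := fun c v => by ext; simp }
      map_add' := fun f g => by ext; simp [TensorProduct.add_tmul]
      map_smul' := fun c f => by ext; simp [TensorProduct.smul_tmul'] }

@[simp]
theorem homTensorRight_tmul_apply (f : A →ₗ[R] Y) (v : V) (a : A) :
    homTensorRight k R A Y V (f ⊗ₜ v) a = f a ⊗ₜ v := rfl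

/-- In a basis of `V`, a map `A → Y ⊗ V` is a family of maps `A → Y`. Only finitely many of them are
nonzero, since this can be tested on finitely many generators of `A`. -/
theorem homTensorRight_bijective [Module.Finite R A] :
    Function.Bijective (homTensorRight k R A Y V) := by
  classical
  let b := Module.Basis.ofVectorSpace k V
  have key (t : (A →ₗ[R] Y) ⊗[k] V) (a : A) (i) :
      TensorProduct.equivFinsuppOfBasisRight b (homTensorRight k R A Y V t a) i =
        TensorProduct.equivFinsuppOfBasisRight b t i a := by
    induction t with
    | zero => simp
    | add x y hx hy => simp [hx, hy]
    | tmul f v => simp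
  constructor
  · rw [injective_iff_map_eq_zero]
    intro t ht
    apply (TensorProduct.equivFinsuppOfBasisRight b).injective
    ext i a
    rw [← key, ht]
    simp
  · intro f
    have hsmul (i) (r : R) (z : Y ⊗[k] V) : TensorProduct.equivFinsuppOfBasisRight b (r • z) i =
        r • TensorProduct.equivFinsuppOfBasisRight b z i := by
      induction z with
      | zero => simp
      | add x y hx hy => simp [hx, hy]
      | tmul y v => 
        rw [TensorProduct.smul_tmul', TensorProduct.equivFinsuppOfBasisRight_apply_tmul_apply,
          TensorProduct.equivFinsuppOfBasisRight_apply_tmul_apply, smul_comm]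
    let c (i) : A →ₗ[R] Y :=
      { toFun := fun a => TensorProduct.equivFinsuppOfBasisRight b (f a) i
        map_add' := fun x y => by simp
        map_smul' := fun r x => by simp [hsmul] }
    obtain ⟨s, hs⟩ := (Module.Finite.fg_top : (⊤ : Submodule R A).FG)
    let T := s.biUnion fun a => (TensorProduct.equivFinsuppOfBasisRight b (f a)).support
    have hT (i) (hi : i ∉ T) : c i = 0 := by
      refine LinearMap.ext_on hs fun a ha => ?_
      by_contra hne
      exact hi (Finset.mem_biUnion.2 ⟨a, ha, Finsupp.mem_support_iff.2 hne⟩)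
    refine ⟨∑ i ∈ T, c i ⊗ₜ b i, ?_⟩
    ext a
    apply (TensorProduct.equivFinsuppOfBasisRight b).injective
    ext i
    rw [key]
    simp only [map_sum, TensorProduct.equivFinsuppOfBasisRight_apply_tmul, Finsupp.coe_finsetSum,
      Finset.sum_apply, Finsupp.mapRange_apply, Module.Basis.repr_self, Finsupp.single_apply,
      ite_smul, one_smul, zero_smul, Finset.sum_ite_eq']
    split_ifs with hi
    · rfl
    · exact (LinearMap.congr_fun (hT i hi) a).symm

end HomTensor

section TensorMap

attribute [local instance] tensorModule

variable {k : Type w} [Field k] {R₁ : Type u} {R₂ : Type v} [CommRing R₁] [CommRing R₂]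
  [Algebra k R₁] [Algebra k R₂]
  {A₁ B₁ C₁ : Type u} {A₂ B₂ C₂ : Type v}
  [AddCommGroup A₁] [Module k A₁] [Module R₁ A₁] [IsScalarTower k R₁ A₁]
  [AddCommGroup A₂] [Module k A₂] [Module R₂ A₂] [IsScalarTower k R₂ A₂]
  [AddCommGroup B₁] [Module k B₁] [Module R₁ B₁] [IsScalarTower k R₁ B₁]
  [AddCommGroup B₂] [Module k B₂] [Module R₂ B₂] [IsScalarTower k R₂ B₂]
  [AddCommGroup C₁] [Module k C₁] [Module R₁ C₁] [IsScalarTower k R₁ C₁]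
  [AddCommGroup C₂] [Module k C₂] [Module R₂ C₂] [IsScalarTower k R₂ C₂]

theorem tensorHom_ext {M : Type*} [AddCommGroup M] [Module (R₁ ⊗[k] R₂) M]
    {f g : A₁ ⊗[k] A₂ →ₗ[R₁ ⊗[k] R₂] M} (h : ∀ x y, f (x ⊗ₜ y) = g (x ⊗ₜ y)) : f = g := by
  ext z
  induction z with
  | zero => rw [map_zero, map_zero]
  | add x y hx hy => rw [map_add, map_add, hx, hy]
  | tmul x y => exact h x y

/-- The tensor product over `k` of an `R₁`-linear and an `R₂`-linear map, as an
`R₁ ⊗ R₂`-linear map. -/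
noncomputable def tensorMap (f : A₁ →ₗ[R₁] B₁) (g : A₂ →ₗ[R₂] B₂) :
    A₁ ⊗[k] A₂ →ₗ[R₁ ⊗[k] R₂] B₁ ⊗[k] B₂ where
  __ := TensorProduct.map (f.restrictScalars k) (g.restrictScalars k)
  map_smul' s x := by
    induction s with
    | zero => simp
    | add s t hs ht => simp only [add_smul, map_add, AddHom.toFun_eq_coe, LinearMap.coe_toAddHom,
        RingHom.id_apply] at *; rw [hs, ht]
    | tmul r s =>
      induction x with
      | zero => simp
      | add x y hx hy => simp only [smul_add, map_add, AddHom.toFun_eq_coe, LinearMap.coe_toAddHom,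
        RingHom.id_apply] at *; rw [hx, hy]
      | tmul x y =>
        rw [tensorModule_tmul_smul_tmul]
        simp [tensorModule_tmul_smul_tmul]

@[simp]
theorem tensorMap_tmul (f : A₁ →ₗ[R₁] B₁) (g : A₂ →ₗ[R₂] B₂) (x : A₁) (y : A₂) :
    tensorMap (k := k) f g (x ⊗ₜ y) = f x ⊗ₜ g y := rfl

theorem tensorMap_comp (f : A₁ →ₗ[R₁] B₁) (g : A₂ →ₗ[R₂] B₂) (f' : B₁ →ₗ[R₁] C₁)
    (g' : B₂ →ₗ[R₂] C₂) :
    tensorMap (k := k) f' g' ∘ₗ tensorMap f g = tensorMap (f' ∘ₗ f) (g' ∘ₗ g) :=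
  tensorHom_ext fun _ _ => rfl

variable (k R₁ R₂ A₁ B₁ A₂ B₂) in
/-- The canonical map `Hom_{R₁}(A₁, B₁) ⊗ Hom_{R₂}(A₂, B₂) → Hom_{R₁ ⊗ R₂}(A₁ ⊗ A₂, B₁ ⊗ B₂)`. -/
noncomputable def homTensorHom :
    (A₁ →ₗ[R₁] B₁) ⊗[k] (A₂ →ₗ[R₂] B₂) →+ (A₁ ⊗[k] A₂ →ₗ[R₁ ⊗[k] R₂] B₁ ⊗[k] B₂) :=
  TensorProduct.liftAddHom
    (AddMonoidHom.mk' (fun f => AddMonoidHom.mk' (fun g => tensorMap (k := k) f g)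
        fun g g' => tensorHom_ext fun x y => by
          simp [TensorProduct.tmul_add])
      fun f f' => AddMonoidHom.ext fun g => tensorHom_ext fun x y =>
        TensorProduct.add_tmul (f x) (f' x) (g y))
    fun c f g => tensorHom_ext fun x y => TensorProduct.smul_tmul c (f x) (g y)

@[simp]
theorem homTensorHom_tmul (f : A₁ →ₗ[R₁] B₁) (g : A₂ →ₗ[R₂] B₂) :
    homTensorHom k R₁ R₂ A₁ B₁ A₂ B₂ (f ⊗ₜ g) = tensorMap f g := rfl

/-- `homTensorHom` is the composition of two maps `homTensorRight`, by the identification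
`Hom_{R₁ ⊗ R₂}(A₁ ⊗ A₂, -) = Hom_{R₂}(A₂, Hom_{R₁}(A₁, -))`. -/
theorem homTensorHom_apply_tmul (t : (A₁ →ₗ[R₁] B₁) ⊗[k] (A₂ →ₗ[R₂] B₂)) (x : A₁) (y : A₂) :
    homTensorHom k R₁ R₂ A₁ B₁ A₂ B₂ t (x ⊗ₜ y) =
      homTensorRight k R₁ A₁ B₁ B₂ (TensorProduct.comm k _ _
        (homTensorRight k R₂ A₂ B₂ (A₁ →ₗ[R₁] B₁) (TensorProduct.comm k _ _ t) y)) x := by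
  induction t with
  | zero => simp
  | add s t hs ht => simp [hs, ht]
  | tmul f g => simp

/-- Over a field, `Hom` commutes with tensor products for finitely generated modules: finite
presentation is not needed, because `homTensorRight` is already bijective for them. -/
theorem homTensorHom_bijective [Module.Finite R₁ A₁] [Module.Finite R₂ A₂] :
    Function.Bijective (homTensorHom k R₁ R₂ A₁ B₁ A₂ B₂) := by
  constructor
  · rw [injective_iff_map_eq_zero]
    intro t ht
    apply (TensorProduct.comm k _ _).injective
    apply (homTensorRight_bijective (k := k) (R := R₂) (A := A₂) (Y := B₂)
      (V := A₁ →ₗ[R₁] B₁)).1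
    ext y
    apply (TensorProduct.comm k _ _).injective
    apply (homTensorRight_bijective (k := k) (R := R₁) (A := A₁) (Y := B₁) (V := B₂)).1
    ext x
    rw [← homTensorHom_apply_tmul, ht]
    simp
  · intro φ
    let E := LinearEquiv.ofBijective (homTensorRight k R₁ A₁ B₁ B₂) homTensorRight_bijective
    let E' := LinearEquiv.ofBijective (homTensorRight k R₂ A₂ B₂ (A₁ →ₗ[R₁] B₁))
      homTensorRight_bijective
    -- the map `x ↦ φ (x ⊗ y)`
    let slice (y : A₂) : A₁ →ₗ[R₁] B₁ ⊗[k] B₂ :=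
      { toFun := fun x => φ (x ⊗ₜ y)
        map_add' := fun x x' => by rw [TensorProduct.add_tmul, map_add]
        map_smul' := fun r x => by
          have h1 : (r • x) ⊗ₜ[k] y = (r ⊗ₜ[k] (1 : R₂)) • (x ⊗ₜ[k] y) := by
            rw [tensorModule_tmul_smul_tmul, one_smul]
          rw [h1, map_smul]
          induction φ (x ⊗ₜ y) with
          | zero => simp
          | add x y hx hy => simp only [smul_add, hx, hy]
          | tmul x y => simp [tensorModule_tmul_smul_tmul, TensorProduct.smul_tmul'] }
    have hE (s : R₂) (z : B₂ ⊗[k] (A₁ →ₗ[R₁] B₁)) (x : A₁) :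
        E (TensorProduct.comm k _ _ (s • z)) x =
          ((1 : R₁) ⊗ₜ[k] s) • E (TensorProduct.comm k _ _ z) x := by
      induction z with
      | zero => simp
      | add z z' hz hz' => simp only [smul_add, map_add, LinearMap.add_apply, hz, hz']
      | tmul b f => simp [E, TensorProduct.smul_tmul', tensorModule_tmul_smul_tmul]
    let ψ : A₂ →ₗ[R₂] B₂ ⊗[k] (A₁ →ₗ[R₁] B₁) :=
      { toFun := fun y => (TensorProduct.comm k _ _).symm (E.symm (slice y))
        map_add' := fun y y' => by
          rw [← map_add, ← map_add]
          congr 2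
          ext x
          simp [slice, TensorProduct.tmul_add]
        map_smul' := fun s y => by
          apply (TensorProduct.comm k _ _).injective
          apply E.injective
          ext x
          rw [RingHom.id_apply, hE]
          simp only [LinearEquiv.apply_symm_apply]
          change φ (x ⊗ₜ (s • y)) = _ • φ (x ⊗ₜ y)
          rw [← map_smul, tensorModule_tmul_smul_tmul, one_smul] }
    refine ⟨(TensorProduct.comm k _ _).symm (E'.symm ψ), ?_⟩
    refine tensorHom_ext fun x y => ?_
    rw [homTensorHom_apply_tmul, LinearEquiv.apply_symm_apply]
    change E (TensorProduct.comm k _ _ (E' (E'.symm ψ) y)) x = _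
    rw [LinearEquiv.apply_symm_apply]
    change E (TensorProduct.comm k _ _ ((TensorProduct.comm k _ _).symm (E.symm (slice y)))) x = _
    rw [LinearEquiv.apply_symm_apply, LinearEquiv.apply_symm_apply]
    rfl

end TensorMap

/-! ### Homothety and finiteness for tensor products -/

theorem TensorProduct.bijective_left_and_right_of_map_bijective {k M N M' N' : Type*} [Field k]
    [AddCommGroup M] [AddCommGroup N] [AddCommGroup M'] [AddCommGroup N']
    [Module k M] [Module k N] [Module k M'] [Module k N'] [Nontrivial M] [Nontrivial N]
    {f : M →ₗ[k] M'} {g : N →ₗ[k] N'} (h : Function.Bijective (TensorProduct.map f g)) :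
    Function.Bijective f ∧ Function.Bijective g := by
  have hnt : Nontrivial (M' ⊗[k] N') := h.1.nontrivial
  have hM' : Nontrivial M' := by
    by_contra hn
    rw [not_nontrivial_iff_subsingleton] at hn
    exact not_subsingleton (M' ⊗[k] N') inferInstance
  have hN' : Nontrivial N' := by
    by_contra hn
    rw [not_nontrivial_iff_subsingleton] at hn
    exact not_subsingleton (M' ⊗[k] N') inferInstance
  have h1 : TensorProduct.map f g = f.rTensor N' ∘ₗ g.lTensor M :=
    (LinearMap.rTensor_comp_lTensor _ _ _).symm
  have h2 : TensorProduct.map f g = g.lTensor M' ∘ₗ f.rTensor N :=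
    (LinearMap.lTensor_comp_rTensor _ _ _).symm
  have i1 : Function.Injective (g.lTensor M) := by
    rw [h1] at h; exact Function.Injective.of_comp (f := f.rTensor N') h.1
  have i2 : Function.Injective (f.rTensor N) := by
    rw [h2] at h; exact Function.Injective.of_comp (f := g.lTensor M') h.1
  have s1 : Function.Surjective (f.rTensor N') := by
    rw [h1] at h; exact Function.Surjective.of_comp (g := g.lTensor M) h.2
  have s2 : Function.Surjective (g.lTensor M') := by
    rw [h2] at h; exact Function.Surjective.of_comp (g := f.rTensor N) h.2
  rw [← LinearMap.lTensor_inj_iff_rTensor_inj] at i2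
  rw [← LinearMap.lTensor_surj_iff_rTensor_surj] at s1
  exact ⟨⟨(Module.FaithfullyFlat.lTensor_injective_iff_injective k N f).1 i2,
    (Module.FaithfullyFlat.lTensor_surjective_iff_surjective k N' f).1 s1⟩,
    (Module.FaithfullyFlat.lTensor_injective_iff_injective k M g).1 i1,
    (Module.FaithfullyFlat.lTensor_surjective_iff_surjective k M' g).1 s2⟩

section Homothety

attribute [local instance] tensorModule

variable {k : Type w} [Field k] {R₁ : Type u} {R₂ : Type v} [CommRing R₁] [CommRing R₂]
  [Algebra k R₁] [Algebra k R₂] {X₁ : Type u} {X₂ : Type v}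
  [AddCommGroup X₁] [Module k X₁] [Module R₁ X₁] [IsScalarTower k R₁ X₁]
  [AddCommGroup X₂] [Module k X₂] [Module R₂ X₂] [IsScalarTower k R₂ X₂]

/-- The homothety of `X₁ ⊗ X₂` is the tensor product of the homotheties of `X₁` and `X₂`. -/
theorem homTensorHom_map_lsmul (s : R₁ ⊗[k] R₂) :
    homTensorHom k R₁ R₂ X₁ X₁ X₂ X₂
      (TensorProduct.map ((LinearMap.lsmul R₁ X₁ : R₁ →ₗ[R₁] (X₁ →ₗ[R₁] X₁)).restrictScalars k)
        ((LinearMap.lsmul R₂ X₂ : R₂ →ₗ[R₂] (X₂ →ₗ[R₂] X₂)).restrictScalars k) s) =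
      (LinearMap.lsmul (R₁ ⊗[k] R₂) (X₁ ⊗[k] X₂) s) := by
  induction s with
  | zero => simp
  | add s t hs ht => simp only [map_add, hs, ht]
  | tmul r s =>
    exact tensorHom_ext fun x y => rfl

theorem lsmul_tensor_bijective_iff [Module.Finite R₁ X₁] [Module.Finite R₂ X₂]
    [Nontrivial R₁] [Nontrivial R₂] :
    Function.Bijective (LinearMap.lsmul (R₁ ⊗[k] R₂) (X₁ ⊗[k] X₂) :
        R₁ ⊗[k] R₂ →ₗ[R₁ ⊗[k] R₂] (X₁ ⊗[k] X₂ →ₗ[R₁ ⊗[k] R₂] X₁ ⊗[k] X₂)) ↔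
      Function.Bijective (LinearMap.lsmul R₁ X₁ : R₁ →ₗ[R₁] (X₁ →ₗ[R₁] X₁)) ∧
      Function.Bijective (LinearMap.lsmul R₂ X₂ : R₂ →ₗ[R₂] (X₂ →ₗ[R₂] X₂)) := by
  have hcomp : (LinearMap.lsmul (R₁ ⊗[k] R₂) (X₁ ⊗[k] X₂) :
        R₁ ⊗[k] R₂ → (X₁ ⊗[k] X₂ →ₗ[R₁ ⊗[k] R₂] X₁ ⊗[k] X₂)) =
      homTensorHom k R₁ R₂ X₁ X₁ X₂ X₂ ∘
      (TensorProduct.map ((LinearMap.lsmul R₁ X₁ : R₁ →ₗ[R₁] (X₁ →ₗ[R₁] X₁)).restrictScalars k)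
        ((LinearMap.lsmul R₂ X₂ : R₂ →ₗ[R₂] (X₂ →ₗ[R₂] X₂)).restrictScalars k)) :=
    funext fun s => (homTensorHom_map_lsmul s).symm
  rw [hcomp, Function.Bijective.of_comp_iff' homTensorHom_bijective]
  constructor
  · exact TensorProduct.bijective_left_and_right_of_map_bijective
  · rintro ⟨h₁, h₂⟩
    exact TensorProduct.map_bijective h₁ h₂

theorem tensor_finite [Module.Finite R₁ X₁] [Module.Finite R₂ X₂] :
    Module.Finite (R₁ ⊗[k] R₂) (X₁ ⊗[k] X₂) := by
  obtain ⟨s, hs⟩ := (Module.Finite.fg_top : (⊤ : Submodule R₁ X₁).FG)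
  obtain ⟨t, ht⟩ := (Module.Finite.fg_top : (⊤ : Submodule R₂ X₂).FG)
  classical
  refine ⟨Finset.image₂ (fun x y => x ⊗ₜ[k] y) s t, ?_⟩
  rw [eq_top_iff]
  rintro z -
  induction z with
  | zero => exact zero_mem _
  | add x y hx hy => exact add_mem hx hy
  | tmul x y =>
    have hx : x ∈ Submodule.span R₁ (s : Set X₁) := hs ▸ Submodule.mem_top
    have hy : y ∈ Submodule.span R₂ (t : Set X₂) := ht ▸ Submodule.mem_top
    induction hx using Submodule.span_induction with
    | zero => rw [TensorProduct.zero_tmul]; exact zero_mem _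
    | add a b _ _ ha hb => rw [TensorProduct.add_tmul]; exact add_mem ha hb
    | smul r a _ ha =>
      have := Submodule.smul_mem _ (r ⊗ₜ[k] (1 : R₂)) ha
      rwa [tensorModule_tmul_smul_tmul, one_smul] at this
    | mem x hx =>
      induction hy using Submodule.span_induction with
      | zero => rw [TensorProduct.tmul_zero]; exact zero_mem _
      | add a b _ _ ha hb => rw [TensorProduct.tmul_add]; exact add_mem ha hb
      | smul r a _ ha =>
        have := Submodule.smul_mem _ ((1 : R₁) ⊗ₜ[k] r) ha
        rwa [tensorModule_tmul_smul_tmul, one_smul] at this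
      | mem y hy =>
        exact Submodule.subset_span (Finset.mem_coe.2 (Finset.mem_image₂_of_mem hx hy))

theorem rid_lTensor_smul (l : Module.Dual k X₂) (r : R₁) (z : X₁ ⊗[k] X₂) :
    TensorProduct.rid k X₁ (l.lTensor X₁ ((r ⊗ₜ[k] (1 : R₂)) • z)) =
      r • TensorProduct.rid k X₁ (l.lTensor X₁ z) := by
  induction z with
  | zero => simp
  | add a b ha hb => simp only [smul_add, map_add, ha, hb]
  | tmul a b =>
    rw [tensorModule_tmul_smul_tmul, one_smul]
    simp only [LinearMap.lTensor_tmul, TensorProduct.rid_tmul]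
    exact smul_comm _ _ _

theorem lid_rTensor_smul (l : Module.Dual k X₁) (r : R₂) (z : X₁ ⊗[k] X₂) :
    TensorProduct.lid k X₂ (l.rTensor X₂ (((1 : R₁) ⊗ₜ[k] r) • z)) =
      r • TensorProduct.lid k X₂ (l.rTensor X₂ z) := by
  induction z with
  | zero => simp
  | add a b ha hb => simp only [smul_add, map_add, ha, hb]
  | tmul a b =>
    rw [tensorModule_tmul_smul_tmul, one_smul]
    simp only [LinearMap.rTensor_tmul, TensorProduct.lid_tmul]
    exact smul_comm _ _ _

end Homothety


/-! ### The exact functors `- ⊗ X₂` and `X₁ ⊗ -` -/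

section Functors

attribute [local instance] tensorModule ModuleCat.moduleOfAlgebraModule
  ModuleCat.isScalarTower_of_algebra_moduleCat

variable (k : Type w) [Field k] (R₁ : Type u) (R₂ : Type v) [CommRing R₁] [CommRing R₂]
  [Algebra k R₁] [Algebra k R₂] (X₁ : Type u) (X₂ : Type v)
  [AddCommGroup X₁] [Module k X₁] [Module R₁ X₁] [IsScalarTower k R₁ X₁]
  [AddCommGroup X₂] [Module k X₂] [Module R₂ X₂] [IsScalarTower k R₂ X₂]

/-- The functor `M ↦ M ⊗ X₂` from `R₁`-modules to `R₁ ⊗ R₂`-modules, where `k` acts on `M` through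
`R₁`. -/
noncomputable def tensorRightFunctor : ModuleCat.{u} R₁ ⥤ ModuleCat.{max u v} (R₁ ⊗[k] R₂) where
  obj M := ModuleCat.of (R₁ ⊗[k] R₂) (M ⊗[k] X₂)
  map f := ModuleCat.ofHom (tensorMap f.hom LinearMap.id)
  map_id _ := ModuleCat.hom_ext (tensorHom_ext fun _ _ => rfl)
  map_comp _ _ := ModuleCat.hom_ext (tensorHom_ext fun _ _ => rfl)

/-- The functor `M ↦ X₁ ⊗ M` from `R₂`-modules to `R₁ ⊗ R₂`-modules, where `k` acts on `M` through
`R₂`. -/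
noncomputable def tensorLeftFunctor : ModuleCat.{v} R₂ ⥤ ModuleCat.{max u v} (R₁ ⊗[k] R₂) where
  obj M := ModuleCat.of (R₁ ⊗[k] R₂) (X₁ ⊗[k] M)
  map f := ModuleCat.ofHom (tensorMap LinearMap.id f.hom)
  map_id _ := ModuleCat.hom_ext (tensorHom_ext fun _ _ => rfl)
  map_comp _ _ := ModuleCat.hom_ext (tensorHom_ext fun _ _ => rfl)

instance : (tensorRightFunctor k R₁ R₂ X₂).Additive where
  map_add := ModuleCat.hom_ext (tensorHom_ext fun _ _ => TensorProduct.add_tmul _ _ _)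

instance : (tensorLeftFunctor k R₁ R₂ X₁).Additive where
  map_add := ModuleCat.hom_ext (tensorHom_ext fun _ _ => TensorProduct.tmul_add _ _ _)

theorem tensorRightFunctor_map_exact (S : ShortComplex (ModuleCat.{u} R₁)) (h : S.Exact) :
    (S.map (tensorRightFunctor k R₁ R₂ X₂)).Exact := by
  rw [ShortComplex.ShortExact.moduleCat_exact_iff_function_exact] at h ⊢
  exact Module.Flat.rTensor_exact X₂ (f := S.f.hom.restrictScalars k)
    (g := S.g.hom.restrictScalars k) h

theorem tensorLeftFunctor_map_exact (S : ShortComplex (ModuleCat.{v} R₂)) (h : S.Exact) :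
    (S.map (tensorLeftFunctor k R₁ R₂ X₁)).Exact := by
  rw [ShortComplex.ShortExact.moduleCat_exact_iff_function_exact] at h ⊢
  exact Module.Flat.lTensor_exact X₁ (f := S.f.hom.restrictScalars k)
    (g := S.g.hom.restrictScalars k) h

instance : PreservesFiniteLimits (tensorRightFunctor k R₁ R₂ X₂) := by
  have h := ((Functor.exact_tfae (tensorRightFunctor k R₁ R₂ X₂)).out 1 3).mp
    (tensorRightFunctor_map_exact k R₁ R₂ X₂)
  exact h.1

instance : PreservesFiniteColimits (tensorRightFunctor k R₁ R₂ X₂) := by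
  have h := ((Functor.exact_tfae (tensorRightFunctor k R₁ R₂ X₂)).out 1 3).mp
    (tensorRightFunctor_map_exact k R₁ R₂ X₂)
  exact h.2

instance : PreservesFiniteLimits (tensorLeftFunctor k R₁ R₂ X₁) := by
  have h := ((Functor.exact_tfae (tensorLeftFunctor k R₁ R₂ X₁)).out 1 3).mp
    (tensorLeftFunctor_map_exact k R₁ R₂ X₁)
  exact h.1

instance : PreservesFiniteColimits (tensorLeftFunctor k R₁ R₂ X₁) := by
  have h := ((Functor.exact_tfae (tensorLeftFunctor k R₁ R₂ X₁)).out 1 3).mp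
    (tensorLeftFunctor_map_exact k R₁ R₂ X₁)
  exact h.2

/-- Vanishing of `Ext` descends along `- ⊗ X₂` for nonzero `X₂`: a nonzero vector `x` of `X₂` and a
linear form taking the value `1` at `x` exhibit every `R₁`-module `M` as a retract of `M ⊗ X₂`. -/
theorem ext_subsingleton_of_tensorRight [Nontrivial X₂] (M N : ModuleCat.{u} R₁) (n : ℕ)
    [Subsingleton (Ext ((tensorRightFunctor k R₁ R₂ X₂).obj M)
      ((tensorRightFunctor k R₁ R₂ X₂).obj N) n)] : Subsingleton (Ext M N n) := by
  obtain ⟨x, hx⟩ := exists_ne (0 : X₂)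
  obtain ⟨l, hl⟩ := Module.Projective.exists_dual_eq_one k hx
  refine ModuleCat.ext_subsingleton_of_semilinear_retract.{u, v}
    (Algebra.TensorProduct.includeLeft : R₁ →ₐ[k] R₁ ⊗[k] R₂).toRingHom
    (tensorRightFunctor k R₁ R₂ X₂)
    (fun M => ((TensorProduct.mk k M X₂).flip x).toAddMonoidHom)
    (fun M => (TensorProduct.rid k M ∘ₗ l.lTensor M).toAddMonoidHom)
    (fun M r m => ?_) (fun M r z => ?_) (fun f m => ?_) (fun {M N} f z => ?_) (fun M m => ?_) M N n
  · change (r • m) ⊗ₜ[k] x = (r ⊗ₜ[k] (1 : R₂)) • (m ⊗ₜ[k] x)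
    rw [tensorModule_tmul_smul_tmul, one_smul]
  · exact rid_lTensor_smul l r z
  · rfl
  · change TensorProduct.rid k N (l.lTensor N (tensorMap f.hom LinearMap.id z)) =
      f (TensorProduct.rid k M (l.lTensor M z))
    induction z using TensorProduct.induction_on with
    | zero => simp only [map_zero]
    | add a b ha hb => simp only [map_add, ha, hb]
    | tmul a b => exact ((f.hom.restrictScalars k).map_smul (l b) a).symm
  · change TensorProduct.rid k M (l.lTensor M (m ⊗ₜ[k] x)) = m
    rw [LinearMap.lTensor_tmul, TensorProduct.rid_tmul, hl, one_smul]

theorem ext_subsingleton_of_tensorLeft [Nontrivial X₁] (M N : ModuleCat.{v} R₂) (n : ℕ)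
    [Subsingleton (Ext ((tensorLeftFunctor k R₁ R₂ X₁).obj M)
      ((tensorLeftFunctor k R₁ R₂ X₁).obj N) n)] : Subsingleton (Ext M N n) := by
  obtain ⟨x, hx⟩ := exists_ne (0 : X₁)
  obtain ⟨l, hl⟩ := Module.Projective.exists_dual_eq_one k hx
  refine ModuleCat.ext_subsingleton_of_semilinear_retract.{v, u}
    (Algebra.TensorProduct.includeRight : R₂ →ₐ[k] R₁ ⊗[k] R₂).toRingHom
    (tensorLeftFunctor k R₁ R₂ X₁)
    (fun M => (TensorProduct.mk k X₁ M x).toAddMonoidHom)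
    (fun M => (TensorProduct.lid k M ∘ₗ l.rTensor M).toAddMonoidHom)
    (fun M r m => ?_) (fun M r z => ?_) (fun f m => ?_) (fun {M N} f z => ?_) (fun M m => ?_) M N n
  · change x ⊗ₜ[k] (r • m) = ((1 : R₁) ⊗ₜ[k] r) • (x ⊗ₜ[k] m)
    rw [tensorModule_tmul_smul_tmul, one_smul]
  · exact lid_rTensor_smul l r z
  · rfl
  · change TensorProduct.lid k N (l.rTensor N (tensorMap LinearMap.id f.hom z)) =
      f (TensorProduct.lid k M (l.rTensor M z))
    induction z using TensorProduct.induction_on with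
    | zero => simp only [map_zero]
    | add a b ha hb => simp only [map_add, ha, hb]
    | tmul a b => exact ((f.hom.restrictScalars k).map_smul (l a) b).symm
  · change TensorProduct.lid k M (l.rTensor M (x ⊗ₜ[k] m)) = m
    rw [LinearMap.rTensor_tmul, TensorProduct.lid_tmul, hl, one_smul]

end Functors

/-! ### Semidualizing tensor products -/

section Main

attribute [local instance] tensorModule

variable {k : Type w} [Field k] {R₁ : Type u} {R₂ : Type v} [CommRing R₁] [CommRing R₂]
  [Algebra k R₁] [Algebra k R₂]

/-- The `R₁ ⊗ R₂`-module `R₁ ⊗ R₂` is projective for the action `tensorModule`. The factors are only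
assumed isomorphic to `R₁` and `R₂`, because the `k`-module structure which an object of `ModuleCat`
inherits from the ring need not be definitionally the one of the algebra. -/
theorem projective_tensor_of_equiv {A₁ : Type u} {A₂ : Type v}
    [AddCommGroup A₁] [Module k A₁] [Module R₁ A₁] [IsScalarTower k R₁ A₁]
    [AddCommGroup A₂] [Module k A₂] [Module R₂ A₂] [IsScalarTower k R₂ A₂]
    (e₁ : R₁ ≃ₗ[R₁] A₁) (e₂ : R₂ ≃ₗ[R₂] A₂) : Module.Projective (R₁ ⊗[k] R₂) (A₁ ⊗[k] A₂) := by
  let e := TensorProduct.congr (e₁.restrictScalars k) (e₂.restrictScalars k)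
  refine Module.Projective.of_equiv
    { e with
      map_smul' := fun s t => ?_ : @LinearEquiv (R₁ ⊗[k] R₂) (R₁ ⊗[k] R₂) _ _ (RingHom.id _)
        (RingHom.id _) _ _ (R₁ ⊗[k] R₂) (A₁ ⊗[k] A₂) _ _ Semiring.toModule _ }
  change e (s * t) = s • e t
  induction s with
  | zero => rw [zero_mul, map_zero, zero_smul]
  | add s s' hs hs' => rw [add_mul, map_add, add_smul, hs, hs']
  | tmul r s =>
    induction t with
    | zero => rw [mul_zero, map_zero, smul_zero]
    | add t t' ht ht' => rw [mul_add, map_add, map_add, smul_add, ht, ht']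
    | tmul r' s' =>
      rw [Algebra.TensorProduct.tmul_mul_tmul]
      change e₁ (r • r') ⊗ₜ[k] e₂ (s • s') = (r ⊗ₜ[k] s) • (e₁ r' ⊗ₜ[k] e₂ s')
      rw [map_smul, map_smul, tensorModule_tmul_smul_tmul]

attribute [local instance] ModuleCat.moduleOfAlgebraModule
  ModuleCat.isScalarTower_of_algebra_moduleCat

/-- Dimension shifting is applied twice, in the first factor with `R₂` as second factor, and then in
the second factor. -/
theorem ext_tensor_subsingleton [IsNoetherianRing R₁] [IsNoetherianRing R₂]
    (C₁ D₁ : ModuleCat.{u} R₁) (C₂ D₂ : ModuleCat.{v} R₂) [Module.Finite R₁ C₁]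
    [Module.Finite R₂ C₂] (h₁ : ∀ n, 0 < n → Subsingleton (Ext C₁ D₁ n))
    (h₂ : ∀ n, 0 < n → Subsingleton (Ext C₂ D₂ n)) (n : ℕ) (hn : 0 < n) :
    Subsingleton (Ext (ModuleCat.of (R₁ ⊗[k] R₂) (C₁ ⊗[k] C₂))
      (ModuleCat.of (R₁ ⊗[k] R₂) (D₁ ⊗[k] D₂)) n) := by
  have proj (Q : ModuleCat.{u} R₁) (P : ModuleCat.{v} R₂) (e₁ : R₁ ≃ₗ[R₁] Q) (e₂ : R₂ ≃ₗ[R₂] P) :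
      Module.Projective (R₁ ⊗[k] R₂) (Q ⊗[k] P) := projective_tensor_of_equiv e₁ e₂
  -- The first factor is resolved while the second one is free of rank one.
  have step (P : ModuleCat.{v} R₂) (e : R₂ ≃ₗ[R₂] P) (m : ℕ) (hm : 0 < m) :
      Subsingleton (Ext (ModuleCat.of (R₁ ⊗[k] R₂) (C₁ ⊗[k] P))
        (ModuleCat.of (R₁ ⊗[k] R₂) (D₁ ⊗[k] D₂)) m) := by
    have : Module.Finite R₂ P := Module.Finite.equiv e
    refine ModuleCat.ext_subsingleton_of_shift (tensorRightFunctor k R₁ R₂ P) D₁ _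
      (fun i hi => ?_) (fun K _ φ => ?_) C₁ h₁ m hm
    · have : Module.Projective (R₁ ⊗[k] R₂) ((tensorRightFunctor k R₁ R₂ P).obj
          (ModuleCat.of R₁ R₁)) :=
        proj (ModuleCat.of R₁ R₁) P (LinearEquiv.refl R₁ R₁) e
      obtain ⟨j, rfl⟩ : ∃ j, i = j + 1 := ⟨i - 1, by lia⟩
      exact Ext.subsingleton_of_projective _ _ j
    · obtain ⟨t, ht⟩ := (homTensorHom_bijective (k := k) (R₁ := R₁) (R₂ := R₂) (A₁ := K)
        (B₁ := D₁) (A₂ := P) (B₂ := D₂)).2 φ.hom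
      obtain rfl : ModuleCat.ofHom (homTensorHom k R₁ R₂ K D₁ P D₂ t) = φ :=
        ModuleCat.hom_ext ht
      clear ht
      induction t with
      | zero => rw [map_zero]; exact zero_mem _
      | add a b ha hb => rw [map_add]; exact add_mem ha hb
      | tmul f g =>
        refine AddSubgroup.subset_closure ⟨ModuleCat.ofHom f,
          ModuleCat.ofHom (tensorMap LinearMap.id g), ModuleCat.hom_ext ?_⟩
        exact (tensorMap_comp f LinearMap.id LinearMap.id g).symm
  refine ModuleCat.ext_subsingleton_of_shift (tensorLeftFunctor k R₁ R₂ C₁) D₂ _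
    (step (ModuleCat.of R₂ R₂) (LinearEquiv.refl R₂ R₂)) (fun K _ φ => ?_) C₂ h₂ n hn
  obtain ⟨t, ht⟩ := (homTensorHom_bijective (k := k) (R₁ := R₁) (R₂ := R₂) (A₁ := C₁)
    (B₁ := D₁) (A₂ := K) (B₂ := D₂)).2 φ.hom
  obtain rfl : ModuleCat.ofHom (homTensorHom k R₁ R₂ C₁ D₁ K D₂ t) = φ := ModuleCat.hom_ext ht
  clear ht
  induction t with
  | zero => rw [map_zero]; exact zero_mem _
  | add a b ha hb => rw [map_add]; exact add_mem ha hb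
  | tmul f g =>
    refine AddSubgroup.subset_closure ⟨ModuleCat.ofHom g,
      ModuleCat.ofHom (tensorMap f LinearMap.id), ModuleCat.hom_ext ?_⟩
    exact (tensorMap_comp LinearMap.id g f LinearMap.id).symm

theorem nontrivial_of_lsmul_bijective {R M : Type*} [CommRing R] [Nontrivial R] [AddCommGroup M]
    [Module R M] (h : Function.Bijective (LinearMap.lsmul R M : R →ₗ[R] (M →ₗ[R] M))) :
    Nontrivial M := by
  by_contra hM
  rw [not_nontrivial_iff_subsingleton] at hM
  exact one_ne_zero (h.1 (LinearMap.ext fun _ => Subsingleton.elim _ _) : (1 : R) = 0)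

variable (k) in
theorem isSemidualizing_tensor_moduleCat_iff [IsNoetherianRing R₁] [IsNoetherianRing R₂]
    [Nontrivial R₁] [Nontrivial R₂] (X₁ : ModuleCat.{u} R₁) (X₂ : ModuleCat.{v} R₂)
    [Module.Finite R₁ X₁] [Module.Finite R₂ X₂] :
    IsSemidualizing (R₁ ⊗[k] R₂) (X₁ ⊗[k] X₂) ↔ IsSemidualizing R₁ X₁ ∧ IsSemidualizing R₂ X₂ := by
  constructor
  · rintro ⟨-, hb, he⟩
    obtain ⟨hb₁, hb₂⟩ := lsmul_tensor_bijective_iff.1 hb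
    have := nontrivial_of_lsmul_bijective hb₁
    have := nontrivial_of_lsmul_bijective hb₂
    refine ⟨⟨inferInstance, hb₁, fun i hi => ?_⟩, ⟨inferInstance, hb₂, fun i hi => ?_⟩⟩
    · have : Subsingleton (Ext ((tensorRightFunctor k R₁ R₂ X₂).obj X₁)
          ((tensorRightFunctor k R₁ R₂ X₂).obj X₁) i) := he i hi
      exact ext_subsingleton_of_tensorRight k R₁ R₂ X₂ X₁ X₁ i
    · have : Subsingleton (Ext ((tensorLeftFunctor k R₁ R₂ X₁).obj X₂)
          ((tensorLeftFunctor k R₁ R₂ X₁).obj X₂) i) := he i hi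
      exact ext_subsingleton_of_tensorLeft k R₁ R₂ X₁ X₂ X₂ i
  · rintro ⟨h₁, h₂⟩
    exact ⟨tensor_finite, lsmul_tensor_bijective_iff.2
      ⟨h₁.homothety_bijective, h₂.homothety_bijective⟩,
      ext_tensor_subsingleton X₁ X₁ X₂ X₂ h₁.ext_eq_zero h₂.ext_eq_zero⟩

end Main

section General

attribute [local instance] tensorModule

variable (k : Type w) [Field k] {R₁ : Type u} {R₂ : Type v} [CommRing R₁] [CommRing R₂]
  [Algebra k R₁] [Algebra k R₂]

/-- An `R`-module carries only one `k`-module structure compatible with the algebra structure of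
`R`. -/
theorem eq_moduleOfAlgebraModule {R : Type*} [CommRing R] [Algebra k R] (M : Type*)
    [AddCommGroup M] [inst : Module k M] [Module R M] [IsScalarTower k R M] :
    inst = ModuleCat.moduleOfAlgebraModule (k := k) (ModuleCat.of R M) :=
  Module.ext' _ _ fun c m => (algebraMap_smul R c m).symm

theorem isSemidualizing_tensor_iff [IsNoetherianRing R₁] [IsNoetherianRing R₂]
    [Nontrivial R₁] [Nontrivial R₂] (X₁ : Type u) (X₂ : Type v)
    [AddCommGroup X₁] [AddCommGroup X₂] [i₁ : Module k X₁] [i₂ : Module k X₂]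
    [Module R₁ X₁] [Module R₂ X₂] [IsScalarTower k R₁ X₁] [IsScalarTower k R₂ X₂]
    [Module.Finite R₁ X₁] [Module.Finite R₂ X₂] :
    IsSemidualizing (R₁ ⊗[k] R₂) (X₁ ⊗[k] X₂) ↔ IsSemidualizing R₁ X₁ ∧ IsSemidualizing R₂ X₂ := by
  obtain rfl := eq_moduleOfAlgebraModule k (R := R₁) X₁
  obtain rfl := eq_moduleOfAlgebraModule k (R := R₂) X₂
  exact isSemidualizing_tensor_moduleCat_iff k (ModuleCat.of R₁ X₁) (ModuleCat.of R₂ X₂)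

end General

/-! ### Recovering the factors -/

/-- Let `C` and `D` be modules over a local ring all of whose endomorphisms are multiplications by
unique scalars. If `g ∘ f` is multiplication by a unit `u`, then `f` is bijective: `f ∘ g` is
multiplication by some `t` with `t * (t - u) = 0`, so that `t` is a unit or zero, and `t = 0` would
give `u * u = 0`. -/
theorem bijective_of_isUnit_comp {R C D : Type*} [CommRing R] [IsLocalRing R]
    [AddCommGroup C] [Module R C] [AddCommGroup D] [Module R D]
    (hC : Function.Bijective (LinearMap.lsmul R C : R →ₗ[R] (C →ₗ[R] C)))
    (hD : Function.Bijective (LinearMap.lsmul R D : R →ₗ[R] (D →ₗ[R] D)))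
    (f : C →ₗ[R] D) (g : D →ₗ[R] C) {u : R} (hu : IsUnit u)
    (h : g ∘ₗ f = LinearMap.lsmul R C u) : Function.Bijective f := by
  obtain ⟨t, ht⟩ := hD.2 (f ∘ₗ g)
  have hgf (x : C) : g (f x) = u • x := LinearMap.congr_fun h x
  have hfg (y : D) : f (g y) = t • y := (LinearMap.congr_fun ht y).symm
  have htu : t * (t - u) = 0 := by
    apply hD.1
    ext y
    have h1 : t • t • y = u • t • y := by
      rw [← hfg y, ← hfg (f (g y)), hgf, map_smul]
    simp only [LinearMap.lsmul_apply, map_zero, LinearMap.zero_apply]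
    rw [mul_sub, sub_smul, mul_smul, h1, mul_comm t u, mul_smul, sub_self]
  have htunit : IsUnit t := by
    by_contra hnt
    have hsub : IsUnit (t - u) := by
      rw [← IsUnit.neg_iff, neg_sub]
      exact (IsLocalRing.isUnit_or_isUnit_of_isUnit_add (a := t) (b := u - t)
        (by rwa [add_sub_cancel])).resolve_left hnt
    have ht0 : t = 0 := (hsub.mul_left_eq_zero).1 htu
    have huu : u * u = 0 := by
      apply hC.1
      ext x
      have h2 : u • u • x = 0 := by
        rw [← hgf x, ← hgf (g (f x)), hfg, ht0, zero_smul, map_zero]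
      simpa [mul_smul] using h2
    exact not_isUnit_zero (huu ▸ hu.mul hu)
  constructor
  · intro x y hxy
    have : u • x = u • y := by rw [← hgf, ← hgf, hxy]
    exact hu.smul_left_cancel.1 this
  · intro y
    obtain ⟨s, hs⟩ := htunit.exists_right_inv
    exact ⟨g (s • y), by rw [hfg, ← mul_smul, hs, one_smul]⟩

section Injective

attribute [local instance] tensorModule

variable {k : Type w} [Field k] {R₁ : Type u} {R₂ : Type v} [CommRing R₁] [CommRing R₂]
  [Algebra k R₁] [Algebra k R₂]
  {C₁ D₁ : Type u} {C₂ D₂ : Type v}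
  [AddCommGroup C₁] [Module k C₁] [Module R₁ C₁] [IsScalarTower k R₁ C₁]
  [AddCommGroup D₁] [Module k D₁] [Module R₁ D₁] [IsScalarTower k R₁ D₁]
  [AddCommGroup C₂] [Module k C₂] [Module R₂ C₂] [IsScalarTower k R₂ C₂]
  [AddCommGroup D₂] [Module k D₂] [Module R₂ D₂] [IsScalarTower k R₂ D₂]

/-- The tensor product of an `R₁`-linear and an `R₂`-linear equivalence. -/
noncomputable def tensorCongr (e₁ : C₁ ≃ₗ[R₁] D₁) (e₂ : C₂ ≃ₗ[R₂] D₂) :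
    C₁ ⊗[k] C₂ ≃ₗ[R₁ ⊗[k] R₂] D₁ ⊗[k] D₂ :=
  LinearEquiv.ofLinearMap (tensorMap e₁.toLinearMap e₂.toLinearMap)
    (tensorMap e₁.symm.toLinearMap e₂.symm.toLinearMap)
    (tensorHom_ext fun x y => by simp) (tensorHom_ext fun x y => by simp)

/-- Write the isomorphism as a sum of tensors `f₁ ⊗ f₂` and its inverse as a sum of tensors
`g₁ ⊗ g₂`. The compositions `g₁ ∘ f₁` and `g₂ ∘ f₂` are multiplications by scalars `r` and `s`, and
the elements `r ⊗ s` sum to `1`. Hence some `r ⊗ s` is nonzero in the tensor product of the residue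
fields, so both `r` and `s` are units. -/
theorem IsSemidualizing.nonempty_equiv_of_tensor_equiv [IsLocalRing R₁] [IsLocalRing R₂]
    (hC₁ : IsSemidualizing R₁ C₁) (hD₁ : IsSemidualizing R₁ D₁)
    (hC₂ : IsSemidualizing R₂ C₂) (hD₂ : IsSemidualizing R₂ D₂)
    (e : C₁ ⊗[k] C₂ ≃ₗ[R₁ ⊗[k] R₂] D₁ ⊗[k] D₂) :
    Nonempty (C₁ ≃ₗ[R₁] D₁) ∧ Nonempty (C₂ ≃ₗ[R₂] D₂) := by
  have := hC₁.finite
  have := hD₁.finite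
  have := hC₂.finite
  have := hD₂.finite
  suffices h : ∃ (f₁ : C₁ →ₗ[R₁] D₁) (g₁ : D₁ →ₗ[R₁] C₁) (f₂ : C₂ →ₗ[R₂] D₂)
      (g₂ : D₂ →ₗ[R₂] C₂) (r : R₁) (s : R₂), IsUnit r ∧ IsUnit s ∧
      g₁ ∘ₗ f₁ = LinearMap.lsmul R₁ C₁ r ∧ g₂ ∘ₗ f₂ = LinearMap.lsmul R₂ C₂ s by
    obtain ⟨f₁, g₁, f₂, g₂, r, s, hr, hs, h₁, h₂⟩ := h
    exact ⟨⟨LinearEquiv.ofBijective f₁ (bijective_of_isUnit_comp hC₁.homothety_bijective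
      hD₁.homothety_bijective f₁ g₁ hr h₁)⟩, ⟨LinearEquiv.ofBijective f₂
      (bijective_of_isUnit_comp hC₂.homothety_bijective hD₂.homothety_bijective f₂ g₂ hs h₂)⟩⟩
  by_contra! hcon
  let π : R₁ ⊗[k] R₂ →ₐ[k] IsLocalRing.ResidueField R₁ ⊗[k] IsLocalRing.ResidueField R₂ :=
    Algebra.TensorProduct.map (IsScalarTower.toAlgHom k R₁ _) (IsScalarTower.toAlgHom k R₂ _)
  -- Every composition of sums of tensors is multiplication by an element of the kernel of `π`.
  have key (t : (C₁ →ₗ[R₁] D₁) ⊗[k] (C₂ →ₗ[R₂] D₂)) (t' : (D₁ →ₗ[R₁] C₁) ⊗[k] (D₂ →ₗ[R₂] C₂)) :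
      ∃ s : R₁ ⊗[k] R₂, π s = 0 ∧ homTensorHom k R₁ R₂ D₁ C₁ D₂ C₂ t' ∘ₗ
        homTensorHom k R₁ R₂ C₁ D₁ C₂ D₂ t = LinearMap.lsmul (R₁ ⊗[k] R₂) (C₁ ⊗[k] C₂) s := by
    induction t with
    | zero => exact ⟨0, map_zero _, by rw [map_zero, map_zero, LinearMap.comp_zero]⟩
    | add a b ha hb =>
      obtain ⟨s, hs, ha⟩ := ha
      obtain ⟨s', hs', hb⟩ := hb
      exact ⟨s + s', by rw [map_add, hs, hs', add_zero],
        by rw [map_add, map_add, LinearMap.comp_add, ha, hb]⟩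
    | tmul f₁ f₂ =>
      induction t' with
      | zero => exact ⟨0, map_zero _, by rw [map_zero, map_zero, LinearMap.zero_comp]⟩
      | add a b ha hb =>
        obtain ⟨s, hs, ha⟩ := ha
        obtain ⟨s', hs', hb⟩ := hb
        exact ⟨s + s', by rw [map_add, hs, hs', add_zero],
          by rw [map_add, map_add, LinearMap.add_comp, ha, hb]⟩
      | tmul g₁ g₂ =>
        obtain ⟨r, hr⟩ := hC₁.homothety_bijective.2 (g₁ ∘ₗ f₁)
        obtain ⟨s, hs⟩ := hC₂.homothety_bijective.2 (g₂ ∘ₗ f₂)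
        refine ⟨r ⊗ₜ s, ?_, ?_⟩
        · change IsLocalRing.residue R₁ r ⊗ₜ[k] IsLocalRing.residue R₂ s = 0
          by_cases hru : IsUnit r
          · have hsu : ¬ IsUnit s := fun hsu => hcon f₁ g₁ f₂ g₂ r s hru hsu hr.symm hs.symm
            rw [(IsLocalRing.residue_eq_zero_iff s).2 hsu, TensorProduct.tmul_zero]
          · rw [(IsLocalRing.residue_eq_zero_iff r).2 hru, TensorProduct.zero_tmul]
        · rw [homTensorHom_tmul, homTensorHom_tmul, tensorMap_comp, ← hr, ← hs]
          exact tensorHom_ext fun x y => rfl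
  obtain ⟨t, ht⟩ := (homTensorHom_bijective (k := k)).2 e.toLinearMap
  obtain ⟨t', ht'⟩ := (homTensorHom_bijective (k := k)).2 e.symm.toLinearMap
  obtain ⟨s, hs, hse⟩ := key t t'
  have hinj := (lsmul_tensor_bijective_iff (k := k).2
    ⟨hC₁.homothety_bijective, hC₂.homothety_bijective⟩).1
  have hs1 : s = 1 := by
    apply hinj
    rw [← hse, ht, ht']
    ext x
    simp
  rw [hs1, map_one] at hs
  exact one_ne_zero hs

end Injective

theorem corollary4p8 (k : Type w) [Field k] (R₁ : Type u) (R₂ : Type v)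
    [CommRing R₁] [IsNoetherianRing R₁] [IsLocalRing R₁] [Algebra k R₁]
    [CommRing R₂] [IsNoetherianRing R₂] [IsLocalRing R₂] [Algebra k R₂] :
    (∀ (X₁ : Type u) (X₂ : Type v) [AddCommGroup X₁] [AddCommGroup X₂] [Module k X₁] [Module k X₂]
        [Module R₁ X₁] [Module R₂ X₂] [IsScalarTower k R₁ X₁] [IsScalarTower k R₂ X₂]
        [Module.Finite R₁ X₁] [Module.Finite R₂ X₂],
      letI := tensorModule k R₁ R₂ X₁ X₂
      IsSemidualizing (R₁ ⊗[k] R₂) (X₁ ⊗[k] X₂) ↔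
        IsSemidualizing R₁ X₁ ∧ IsSemidualizing R₂ X₂) ∧
    ∃ ψ : SemidualizingClasses R₁ × SemidualizingClasses R₂ → SemidualizingClasses (R₁ ⊗[k] R₂),
      (∀ (C₁ : Type u) (C₂ : Type v) [AddCommGroup C₁] [AddCommGroup C₂] [Module k C₁] [Module k C₂]
          [Module R₁ C₁] [Module R₂ C₂] [IsScalarTower k R₁ C₁] [IsScalarTower k R₂ C₂]
          (h₁ : IsSemidualizing R₁ C₁) (h₂ : IsSemidualizing R₂ C₂),
        letI := tensorModule k R₁ R₂ C₁ C₂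
        ∃ h : IsSemidualizing (R₁ ⊗[k] R₂) (C₁ ⊗[k] C₂),
          ψ (SemidualizingClasses.mk R₁ C₁ h₁, SemidualizingClasses.mk R₂ C₂ h₂) =
            SemidualizingClasses.mk (R₁ ⊗[k] R₂) (C₁ ⊗[k] C₂) h) ∧
      Function.Injective ψ := by
  refine ⟨fun X₁ X₂ => isSemidualizing_tensor_iff k X₁ X₂, ?_⟩
  -- An `R₁`-module given without a `k`-structure receives the one restricted from `R₁`, which is the
  -- only compatible one.
  have tens (M : {M : ModuleCat.{u} R₁ // IsSemidualizing R₁ M})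
      (N : {N : ModuleCat.{v} R₂ // IsSemidualizing R₂ N}) :
      letI : Module k M.1 := M.1.moduleOfAlgebraModule
      letI : Module k N.1 := N.1.moduleOfAlgebraModule
      haveI : IsScalarTower k R₁ M.1 := M.1.isScalarTower_of_algebra_moduleCat
      haveI : IsScalarTower k R₂ N.1 := N.1.isScalarTower_of_algebra_moduleCat
      letI := tensorModule k R₁ R₂ M.1 N.1
      IsSemidualizing (R₁ ⊗[k] R₂) (M.1 ⊗[k] N.1) := by
    have := M.2.finite
    have := N.2.finite
    exact (isSemidualizing_tensor_moduleCat_iff k M.1 N.1).2 ⟨M.2, N.2⟩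
  refine ⟨fun p => Quotient.liftOn₂ p.1 p.2 (fun M N =>
    letI : Module k M.1 := M.1.moduleOfAlgebraModule
    letI : Module k N.1 := N.1.moduleOfAlgebraModule
    haveI : IsScalarTower k R₁ M.1 := M.1.isScalarTower_of_algebra_moduleCat
    haveI : IsScalarTower k R₂ N.1 := N.1.isScalarTower_of_algebra_moduleCat
    letI := tensorModule k R₁ R₂ M.1 N.1
    SemidualizingClasses.mk (R₁ ⊗[k] R₂) (M.1 ⊗[k] N.1) (tens M N)) ?_, ?_, ?_⟩
  · rintro M N M' N' ⟨e₁⟩ ⟨e₂⟩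
    let (M : ModuleCat.{u} R₁) : Module k M := M.moduleOfAlgebraModule
    let (M : ModuleCat.{v} R₂) : Module k M := M.moduleOfAlgebraModule
    have (M : ModuleCat.{u} R₁) : IsScalarTower k R₁ M := M.isScalarTower_of_algebra_moduleCat
    have (M : ModuleCat.{v} R₂) : IsScalarTower k R₂ M := M.isScalarTower_of_algebra_moduleCat
    exact Quotient.sound ⟨tensorCongr e₁ e₂⟩
  · intro C₁ C₂ _ _ i₁ i₂ _ _ _ _ h₁ h₂
    obtain rfl := eq_moduleOfAlgebraModule k (R := R₁) C₁
    obtain rfl := eq_moduleOfAlgebraModule k (R := R₂) C₂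
    exact ⟨tens ⟨ModuleCat.of R₁ C₁, h₁⟩ ⟨ModuleCat.of R₂ C₂, h₂⟩, rfl⟩
  · rintro ⟨p₁, p₂⟩ ⟨q₁, q₂⟩ h
    induction p₁ using Quotient.inductionOn with | _ M
    induction p₂ using Quotient.inductionOn with | _ N
    induction q₁ using Quotient.inductionOn with | _ M'
    induction q₂ using Quotient.inductionOn with | _ N'
    let (M : ModuleCat.{u} R₁) : Module k M := M.moduleOfAlgebraModule
    let (M : ModuleCat.{v} R₂) : Module k M := M.moduleOfAlgebraModule
    have (M : ModuleCat.{u} R₁) : IsScalarTower k R₁ M := M.isScalarTower_of_algebra_moduleCat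
    have (M : ModuleCat.{v} R₂) : IsScalarTower k R₂ M := M.isScalarTower_of_algebra_moduleCat
    obtain ⟨e⟩ := Quotient.exact h
    obtain ⟨h₁, h₂⟩ := IsSemidualizing.nonempty_equiv_of_tensor_equiv M.2 M'.2 N.2 N'.2 e
    exact Prod.ext (Quotient.sound h₁) (Quotient.sound h₂)
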